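/- Let $\mathfrak A$ be a countably infinite set of letters and $\mathfrak A^*$ the free monoid of words over it. A monoid variety $\mathbb V$ is \emph{non-finitely based} if its identities have no finite basis, that is, no finite set of identities has exactly the identities of $\mathbb V$ as its consequences. A set $W\subseteq\mathfrak A^*$ is \emph{stable with respect to} $\mathbb V$ if $\mathbf v\in W$ whenever $\mathbf u\in W$ and $\mathbb V$ satisfies $\mathbf u\approx\mathbf v$. Let $\beta$ be the fully invariant congruence on $\mathfrak A^*$ of the monoid variety defined by the identities $xtx\approx xtx^2\approx x^2tx$ and $xy^2x\approx x^2y^2$; that is, $\mathbf u\,\beta\,\mathbf v$ if and only if every monoid satisfying these identities satisfies $\mathbf u\approx\mathbf v$. Let $[\mathbf w]_\beta$ denote the $\beta$-class of a word $\mathbf w$. Let $\mathbb V$ be a monoid variety that satisfies the identity \[ x\,y_1^2y_2^2\cdots y_n^2\,x\;\approx\; x\,y_1^2\,x\,y_2^2\,x\cdots x\,y_n^2\,x \] for every $n\ge 1$. Let $a,b,t\in\mathfrak A$ be distinct letters. Suppose that the sets \[ a^+bb^+ta^+=\{a^i\,b^{j}\,t\,a^k : i\ge 1,\ j\ge 2,\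 k\ge 1\} \quad\text{and}\quad [atb^2a]_\beta \] are stable with respect to $\mathbb V$. Then $\mathbb V$ is non-finitely based. -/

import Mathlib

universe u

/-- Words over a countably infinite alphabet; the letters are the natural numbers. -/
abbrev Word : Type := FreeMonoid ℕ

/-- The letter with index `i`, viewed as a word of length one. -/
abbrev letter (i : ℕ) : Word := FreeMonoid.of i

/-- The monoid `M` satisfies the identity `p ≈ q`: every substitution of elements of `M`
for letters gives `p` and `q` the same value. -/
def MonoidSatisfies (M : Type u) [Monoid M] (p q : Word) : Prop :=
  ∀ φ : Word →* M, φ p = φ q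

/-- A variety of monoids: a class of monoids closed under submonoids, homomorphic images
and arbitrary direct products (the empty product is included, so the class is nonempty;
closure under isomorphism is a special case of closure under homomorphic images). -/
structure MonoidVariety where
  /-- Membership of a monoid in the variety. -/
  Mem : ∀ (M : Type u) [Monoid M], Prop
  submonoid_mem : ∀ (M : Type u) [Monoid M], Mem M → ∀ N : Submonoid M, Mem N
  image_mem : ∀ (M N : Type u) [Monoid M] [Monoid N] (f : M →* N),
    Function.Surjective f → Mem M → Mem N
  pi_mem : ∀ (ι : Type u) (M : ι → Type u) [∀ i, Monoid (M i)],
    (∀ i, Mem (M i)) → Mem (∀ i, M i)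

namespace MonoidVariety

/-- The variety `V` satisfies the identity `p ≈ q`: all its members do. -/
def Satisfies (V : MonoidVariety.{u}) (p q : Word) : Prop :=
  ∀ (M : Type u) [Monoid M], V.Mem M → MonoidSatisfies M p q

/-- `var S`, the variety defined by a set `S` of identities. -/
def ofIdentities (S : Set (Word × Word)) : MonoidVariety.{u} where
  Mem M _ := ∀ e ∈ S, MonoidSatisfies M e.1 e.2
  submonoid_mem M _ h N e he φ := Subtype.ext (h e he (N.subtype.comp φ))
  image_mem M N _ _ f hf h e he φ := by
    choose g hg using hf
    have hφ : φ = f.comp (FreeMonoid.lift fun i => g (φ (FreeMonoid.of i))) :=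
      FreeMonoid.hom_eq fun i => by simp [hg]
    rw [hφ]
    exact congrArg f (h e he _)
  pi_mem ι M _ h e he φ := funext fun i => h i e he ((Pi.evalMonoidHom M i).comp φ)

/-- `V` is finitely based: its identities have a finite basis, that is, there is a finite set `S`
of identities such that the identities of `V` are exactly the consequences of `S` (the identities
satisfied by all monoids satisfying `S`). -/
def FinitelyBased (V : MonoidVariety.{u}) : Prop :=
  ∃ S : Set (Word × Word), S.Finite ∧
    ∀ p q : Word, V.Satisfies p q ↔ (ofIdentities.{u} S).Satisfies p q

/-- The fully invariant congruence of `V` on the free monoid: all identities of `V`. -/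
def congruence (V : MonoidVariety.{u}) : Con Word where
  r := V.Satisfies
  iseqv :=
    { refl := fun _ _ _ _ _ => rfl
      symm := fun h M _ hM φ => (h M hM φ).symm
      trans := fun h k M _ hM φ => (h M hM φ).trans (k M hM φ) }
  mul' := fun h k M _ hM φ => by rw [map_mul, map_mul, h M hM φ, k M hM φ]

/-- A set `W` of words is stable with respect to `V`: it contains `q` whenever it contains
`p` and `V` satisfies `p ≈ q`. -/
def Stable (V : MonoidVariety.{u}) (W : Set Word) : Prop :=
  ∀ p ∈ W, ∀ q : Word, V.Satisfies p q → q ∈ W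

end MonoidVariety

/-- The identities `xtx ≈ xtx²`, `xtx ≈ x²tx`, `xy²x ≈ x²y²`, with `x`, `y`, `t` the letters
`0`, `1`, `2`. -/
def betaIdentities : Set (Word × Word) :=
  {(letter 0 * letter 2 * letter 0, letter 0 * letter 2 * letter 0 ^ 2),
   (letter 0 * letter 2 * letter 0, letter 0 ^ 2 * letter 2 * letter 0),
   (letter 0 * letter 1 ^ 2 * letter 0, letter 0 ^ 2 * letter 1 ^ 2)}

/-- The congruence `β`: the fully invariant congruence of
`var {xtx ≈ xtx² ≈ x²tx, xy²x ≈ x²y²}`. -/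
def beta : Con Word := (MonoidVariety.ofIdentities.{0} betaIdentities).congruence

/-- The `β`-class of a word. -/
def betaClass (w : Word) : Set Word := {v | beta w v}

/-- The set of words `a⁺bb⁺ta⁺`. -/
def aPlusBBPlusTAPlus (a b t : Word) : Set Word :=
  {w | ∃ i j k : ℕ, 1 ≤ i ∧ 1 ≤ j ∧ 1 ≤ k ∧ w = a ^ i * b * b ^ j * t * a ^ k}

/-- `x y₁² y₂² ⋯ yₙ² x`, where `x` is the letter `0` and `yᵢ` is the letter `i`. -/
def wordU (n : ℕ) : Word :=
  letter 0 * ((List.range n).map fun i => letter (i + 1) ^ 2).prod * letter 0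

/-- `x y₁² x y₂² x ⋯ x yₙ² x`, where `x` is the letter `0` and `yᵢ` is the letter `i`. -/
def wordV (n : ℕ) : Word :=
  letter 0 * ((List.range n).map fun i => letter (i + 1) ^ 2 * letter 0).prod

/-!
Let `n` exceed the number of letters of every identity in a finite set of identities of `V`, and
consider the words in which the letters `y₁, …, yₙ` occur in this order, all occurrences of `yᵢ`
before all those of `yⱼ` for `i < j`, and no `x` lies between the first `y₁` and the first `yₙ`.
This set is closed under every substitution instance `A φ(u) B ≈ A φ(v) B` of an identity `u ≈ v` of
`V` in fewer than `n` letters. In the critical case all of `y₁, …, yₙ` occur in `φ(u)`, so by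
pigeonhole `φ(c)` contains two of them for some letter `c`. Then `c` occurs once in `u`, and
stability with `c` in the role of the letter `t` preserves the order of `x` and `y₁` to the left of
`φ(c)` and that of `x` and `yₙ` to its right. As `x y₁² ⋯ yₙ² x` belongs to the set and
`x y₁² x ⋯ x yₙ² x` does not, the finite set is not a basis.
-/

section Words
variable {α β M : Type*} [Monoid M] {c x y z : α} {u v w : FreeMonoid α}

theorem exists_split_of_mem (h : x ∈ w) :
    ∃ s r, w = s * FreeMonoid.of x * r ∧ x ∉ s := by
  obtain ⟨s, r, hw, hs⟩ := List.eq_append_cons_of_mem h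
  exact ⟨.ofList s, .ofList r, FreeMonoid.toList.injective
    ((hw : w.toList = _).trans (by simp [FreeMonoid.toList_mul])), hs⟩

theorem mem_of_mem_freeMonoid_pow {n : ℕ} (h : x ∈ w ^ n) : x ∈ w := by
  induction n with
  | zero => exact (FreeMonoid.notMem_one h).elim
  | succ n ih => exact (FreeMonoid.mem_mul.1 (pow_succ w n ▸ h)).elim ih id

theorem count_toList_pow [DecidableEq α] (w : FreeMonoid α) (n : ℕ) (x : α) :
    (w ^ n).toList.count x = n * w.toList.count x := by
  induction n with
  | zero => simp
  | succ n ih => rw [pow_succ, FreeMonoid.toList_mul, List.count_append, ih, Nat.succ_mul]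

theorem mem_freeMonoidHom_apply_iff (φ : FreeMonoid α →* FreeMonoid β) (u : FreeMonoid α) (k : β) :
    k ∈ φ u ↔ ∃ c ∈ u, k ∈ φ (FreeMonoid.of c) := by
  induction u using FreeMonoid.recOn with
  | one => simp [FreeMonoid.notMem_one]
  | of_mul c u ih => simp [ih]

theorem map_eq_map_of_forall_mem {φ ψ : FreeMonoid α →* M}
    (h : ∀ c ∈ w, φ (FreeMonoid.of c) = ψ (FreeMonoid.of c)) : φ w = ψ w := by
  induction w using FreeMonoid.recOn with
  | one => simp
  | of_mul c w ih =>
    rw [map_mul, map_mul, h c (by simp), ih fun d hd => h d (by simp [hd])]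

theorem map_eq_pow_count [DecidableEq α] {φ : FreeMonoid α →* M}
    (h : ∀ c ∈ w, c ≠ x → φ (FreeMonoid.of c) = 1) :
    φ w = φ (FreeMonoid.of x) ^ w.toList.count x := by
  induction w using FreeMonoid.recOn with
  | one => simp
  | of_mul c w ih =>
    rw [map_mul, ih fun d hd => h d (by simp [hd])]
    obtain rfl | hc := eq_or_ne c x
    · simp [pow_succ']
    · simp [h c (by simp) hc, hc]

/-- Every occurrence of the letter `x` in the word `w` is preceded by a prefix satisfying `P`.
Conditions on the relative order of letters in a word are expressed in this way:
`BeforeEach x (y ∉ ·) w` says that all occurrences of `x` precede all those of `y`, and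
`BeforeEach x (y ∈ ·) w` that each `x` comes after some `y`. -/
def BeforeEach (x : α) (P : FreeMonoid α → Prop) (w : FreeMonoid α) : Prop :=
  ∀ s r, w = s * FreeMonoid.of x * r → P s

/-- No occurrence of `x` in `w` lies between the first occurrences of `y` and `z`. -/
def GapFree (x y z : α) (w : FreeMonoid α) : Prop :=
  BeforeEach x (fun s => y ∈ s → z ∈ s) w

theorem BeforeEach.mono {P Q : FreeMonoid α → Prop} (h : BeforeEach x P w)
    (hPQ : ∀ s r, w = s * FreeMonoid.of x * r → P s → Q s) : BeforeEach x Q w :=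
  fun s r hw => hPQ s r hw (h s r hw)

theorem BeforeEach.gapFree (h : BeforeEach x (y ∉ ·) w) : GapFree x y z w :=
  h.mono fun _ _ _ hy hy' => (hy hy').elim

theorem GapFree.beforeEach_notMem (h : GapFree x y z w) (hz : z ∉ w) : BeforeEach x (y ∉ ·) w :=
  h.mono fun s r hw hyz hy => hz (by simp [hw, hyz hy])

theorem beforeEach_of_notMem {P : FreeMonoid α → Prop} (h : x ∉ w) : BeforeEach x P w :=
  fun s r hw => (h (by simp [hw])).elim

theorem beforeEach_notMem_of_notMem (h : y ∉ w) : BeforeEach x (y ∉ ·) w :=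
  fun s r hw hs => h (by simp [hw, hs])

theorem beforeEach_mul {P : FreeMonoid α → Prop} :
    BeforeEach x P (u * v) ↔ BeforeEach x P u ∧ BeforeEach x (fun s => P (u * s)) v := by
  refine ⟨fun h => ⟨fun s r hu => h s (r * v) (by simp [hu, mul_assoc]),
    fun s r hv => h (u * s) r (by simp [hv, mul_assoc])⟩, fun ⟨hu, hv⟩ s r hw => ?_⟩
  have hw' : u.toList ++ v.toList = s.toList ++ x :: r.toList := by
    simpa [FreeMonoid.toList_mul] using congrArg FreeMonoid.toList hw
  obtain ⟨s', hs, hv'⟩ | ⟨r', hu', hr⟩ := List.append_eq_append_iff.1 hw'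
  · obtain rfl : s = u * .ofList s' := FreeMonoid.toList.injective (by simpa using hs)
    exact hv _ r (FreeMonoid.toList.injective (by simpa [FreeMonoid.toList_mul] using hv'))
  obtain ⟨rfl, hv'⟩ | ⟨r', rfl, -⟩ := List.cons_eq_append_iff.1 hr
  · obtain rfl : s = u := FreeMonoid.toList.injective (by simpa using hu'.symm)
    simpa using hv 1 r (FreeMonoid.toList.injective (by simpa using hv'))
  · exact hu s (.ofList r')
      (FreeMonoid.toList.injective (by simpa [FreeMonoid.toList_mul] using hu'))

theorem BeforeEach.notMem_left (h : BeforeEach x (y ∉ ·) (u * v)) (hx : x ∈ v) : y ∉ u := by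
  obtain ⟨s, r, hv, -⟩ := exists_split_of_mem hx
  exact fun hy => (beforeEach_mul.1 h).2 s r hv (FreeMonoid.mem_mul.2 (.inl hy))

theorem BeforeEach.notMem_middle {A B : FreeMonoid α} (h : BeforeEach x (y ∉ ·) (A * w * B)) :
    BeforeEach x (y ∉ ·) w :=
  fun s r hw hy => h (A * s) (r * B) (by simp only [hw, mul_assoc]) (by simp [hy])

theorem exists_split_of_beforeEach_notMem (hy : y ∈ w)
    (h : BeforeEach x (y ∉ ·) w) : ∃ s r, w = s * FreeMonoid.of y * r ∧ y ∉ s ∧ x ∉ r := by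
  obtain ⟨s, r, rfl, hs⟩ := exists_split_of_mem hy
  exact ⟨s, r, rfl, hs, fun hx => h.notMem_left hx (by simp)⟩

theorem exists_split_of_beforeEach_mem (hy : y ∈ w) (h : BeforeEach x (y ∈ ·) w) :
    ∃ s r, w = s * FreeMonoid.of y * r ∧ y ∉ s ∧ x ∉ s := by
  obtain ⟨s, r, rfl, hs⟩ := exists_split_of_mem hy
  refine ⟨s, r, rfl, hs, fun hx => ?_⟩
  obtain ⟨s', r', rfl, -⟩ := exists_split_of_mem hx
  exact hs (by simp [h s' (r' * FreeMonoid.of y * r) (by simp only [mul_assoc])])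

theorem exists_split_of_count_eq_one [DecidableEq α] (h : w.toList.count x = 1) :
    ∃ s r, w = s * FreeMonoid.of x * r ∧ x ∉ s ∧ x ∉ r := by
  obtain ⟨s, r, rfl, hs⟩ :=
    exists_split_of_mem (List.count_pos_iff.1 (h ▸ Nat.one_pos) : x ∈ w)
  refine ⟨s, r, rfl, hs, fun hr => ?_⟩
  have : 0 < r.toList.count x := List.count_pos_iff.2 hr
  simp only [FreeMonoid.toList_mul, FreeMonoid.toList_of, List.count_append,
    List.count_singleton_self] at h
  omega

theorem exists_ne_mem_map_of_card_symbols_lt [DecidableEq α] {φ : FreeMonoid α →* FreeMonoid β}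
    {I : Finset β} (hI : ∀ k ∈ I, k ∈ φ u) (hcard : u.symbols.card < I.card) :
    ∃ c ∈ u, ∃ k ∈ I, ∃ l ∈ I, k ≠ l ∧ k ∈ φ (FreeMonoid.of c) ∧ l ∈ φ (FreeMonoid.of c) := by
  obtain ⟨k₀, hk₀⟩ : I.Nonempty := Finset.card_pos.1 (Nat.zero_lt_of_lt hcard)
  have : Nonempty α := ⟨((mem_freeMonoidHom_apply_iff φ u k₀).1 (hI k₀ hk₀)).choose⟩
  choose! f hfu hf using fun k hk => (mem_freeMonoidHom_apply_iff φ u k).1 (hI k hk)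
  obtain ⟨k, hk, l, hl, hkl, hfkl⟩ := Finset.exists_ne_map_eq_of_card_lt_of_maps_to (f := f) hcard
    fun k hk => FreeMonoid.mem_symbols.2 (hfu k hk)
  exact ⟨f k, hfu k hk, k, hk, l, hl, hkl, hf k hk, hfkl ▸ hf l hl⟩

theorem count_eq_one_of_beforeEach_notMem_map [DecidableEq α]
    {φ : FreeMonoid α →* FreeMonoid β} {k l : β} (h : BeforeEach k (l ∉ ·) (φ u)) (hc : c ∈ u)
    (hk : k ∈ φ (FreeMonoid.of c)) (hl : l ∈ φ (FreeMonoid.of c)) : u.toList.count c = 1 := by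
  obtain ⟨s, r, rfl, hs⟩ := exists_split_of_mem hc
  have hr : c ∉ r := fun hr => by
    rw [map_mul, map_mul] at h
    exact h.notMem_left ((mem_freeMonoidHom_apply_iff φ r k).2 ⟨c, hr, hk⟩) (by simp [hl])
  have hs' : s.toList.count c = 0 := List.count_eq_zero.2 hs
  have hr' : r.toList.count c = 0 := List.count_eq_zero.2 hr
  simp [FreeMonoid.toList_mul, hs', hr']

end Words

section SyntacticCongruence

/-- The syntactic congruence of a subset `L` of a monoid: two elements are related when they can
be exchanged in every context without affecting membership in `L`. -/
def syntacticCon {M : Type*} [Monoid M] (L : Set M) : Con M where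
  r p q := ∀ A B, A * p * B ∈ L ↔ A * q * B ∈ L
  iseqv := ⟨fun _ _ _ => Iff.rfl, fun h A B => (h A B).symm,
    fun h k A B => (h A B).trans (k A B)⟩
  mul' {w x y z} h k A B := by
    have h' := h A (y * B)
    have k' := k (A * x) B
    simp only [mul_assoc] at h' k' ⊢
    exact h'.trans k'

theorem mem_iff_mem_of_ofIdentities_satisfies {S : Set (Word × Word)} {L : Set Word}
    (hL : ∀ e ∈ S, ∀ (φ : Word →* Word) (A B : Word), A * φ e.1 * B ∈ L ↔ A * φ e.2 * B ∈ L)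
    {p q : Word} (h : (MonoidVariety.ofIdentities.{u} S).Satisfies p q) : p ∈ L ↔ q ∈ L := by
  let π : Word →* ULift.{u} (syntacticCon L).Quotient :=
    MulEquiv.ulift.symm.toMonoidHom.comp (syntacticCon L).mk'
  have π_eq_iff (v w : Word) : π v = π w ↔ syntacticCon L v w :=
    ULift.up_injective.eq_iff.trans (Con.eq _)
  have hπ : (MonoidVariety.ofIdentities.{u} S).Mem (ULift.{u} (syntacticCon L).Quotient) := by
    intro e he φ
    have hsurj : Function.Surjective π :=
      MulEquiv.ulift.symm.surjective.comp (Con.mk'_surjective (c := syntacticCon L))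
    choose g hg using fun i => hsurj (φ (letter i))
    have hφ : φ = π.comp (FreeMonoid.lift g) := FreeMonoid.hom_eq fun i => by simp [hg]
    rw [hφ]
    exact (π_eq_iff _ _).2 (hL e he _)
  simpa using (π_eq_iff p q).1 (h _ hπ π) 1 1

end SyntacticCongruence

section Beta
variable {M : Type u} [Monoid M]

theorem mem_ofIdentities_betaIdentities_iff :
    (MonoidVariety.ofIdentities.{u} betaIdentities).Mem M ↔
      (∀ f g : M, f * g * f = f * g * f ^ 2) ∧ (∀ f g : M, f * g * f = f ^ 2 * g * f) ∧
        ∀ f g : M, f * g ^ 2 * f = f ^ 2 * g ^ 2 := by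
  refine ⟨fun h => ⟨fun f g => ?_, fun f g => ?_, fun f g => ?_⟩, ?_⟩
  · simpa using h _ (.inl rfl) (FreeMonoid.lift fun c => if c = 0 then f else g)
  · simpa using h _ (.inr (.inl rfl)) (FreeMonoid.lift fun c => if c = 0 then f else g)
  · simpa using h _ (.inr (.inr rfl)) (FreeMonoid.lift fun c => if c = 0 then f else g)
  · rintro ⟨h₁, h₂, h₃⟩ e (rfl | rfl | rfl) φ
    · simpa using h₁ _ _
    · simpa using h₂ _ _
    · simpa using h₃ _ _

theorem pow_succ_mul_mul_self (hM : (MonoidVariety.ofIdentities.{u} betaIdentities).Mem M)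
    (f g : M) (i : ℕ) : f ^ (i + 1) * g * f = f * g * f := by
  obtain ⟨-, h₂, -⟩ := mem_ofIdentities_betaIdentities_iff.1 hM
  induction i with
  | zero => simp
  | succ i ih =>
    calc f ^ (i + 1 + 1) * g * f = f * (f ^ (i + 1) * g * f) := by simp only [pow_succ', mul_assoc]
      _ = f ^ 2 * g * f := by rw [ih]; simp only [pow_two, mul_assoc]
      _ = f * g * f := (h₂ f g).symm

theorem mul_mul_sq_mul_mul_of_mem_closure
    (hM : (MonoidVariety.ofIdentities.{u} betaIdentities).Mem M) {x y : M} (t : M) {w : M}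
    (hw : w ∈ Submonoid.closure {x, y}) : x * t * y ^ 2 * x * w = x * t * y ^ 2 * x := by
  obtain ⟨h₁, -, h₃⟩ := mem_ofIdentities_betaIdentities_iff.1 hM
  have hx : x * t * y ^ 2 * x * x = x * t * y ^ 2 * x := by
    have := h₁ x (t * y ^ 2)
    simp only [pow_two, mul_assoc] at this ⊢
    exact this.symm
  have hyy : y * y ^ 2 = y ^ 2 := by simpa [pow_two] using (h₁ y 1).symm
  have hy : x * t * y ^ 2 * x * y = x * t * y ^ 2 * x := by
    calc x * t * y ^ 2 * x * y = x * t * y ^ 2 * x * x * y := by rw [hx]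
      _ = x * t * y * (y * x ^ 2 * y) := by simp only [pow_two, mul_assoc]
      _ = x * t * (y * y ^ 2) * x * x := by rw [h₃]; simp only [pow_two, mul_assoc]
      _ = x * t * y ^ 2 * x := by rw [hyy, hx]
  induction hw using Submonoid.closure_induction_left with
  | one => rw [mul_one]
  | mul_left c hc w _ ih =>
    obtain rfl | rfl := hc
    · rw [← mul_assoc, hx, ih]
    · rw [← mul_assoc, hy, ih]

theorem mul_mul_sq_mul_of_mem_closure
    (hM : (MonoidVariety.ofIdentities.{u} betaIdentities).Mem M) {x y : M} (t : M) {w : M}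
    (hw : w ∈ Submonoid.closure {x, y}) : x * t * y ^ 2 * w * x = x * t * y ^ 2 * x := by
  obtain ⟨h₁, -, -⟩ := mem_ofIdentities_betaIdentities_iff.1 hM
  have hyy : y ^ 2 * y = y ^ 2 := by simpa [pow_two, mul_assoc] using (h₁ y 1).symm
  induction hw using Submonoid.closure_induction_left with
  | one => rw [mul_one]
  | mul_left c hc w hw ih =>
    obtain rfl | rfl := hc
    · have hwc : w * c ∈ Submonoid.closure {c, y} :=
        mul_mem hw (Submonoid.subset_closure (by simp))
      simpa only [mul_assoc] using mul_mul_sq_mul_mul_of_mem_closure hM t hwc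
    · rw [← mul_assoc, mul_assoc _ _ c, hyy, ih]

theorem pow_mul_mul_sq_mul_mul_mem_betaClass (a b t i : ℕ) {w : Word}
    (hw : w ∈ Submonoid.closure {letter a, letter b}) :
    letter a ^ (i + 1) * letter t * letter b ^ 2 * w * letter a ∈
      betaClass (letter a * letter t * letter b ^ 2 * letter a) := by
  intro M _ hM φ
  have hφw : φ w ∈ Submonoid.closure {φ (letter a), φ (letter b)} := by
    simpa [MonoidHom.map_mclosure, Set.image_pair] using Submonoid.mem_map_of_mem φ hw
  have hpow := pow_succ_mul_mul_self hM (φ (letter a))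
    (φ (letter t) * φ (letter b) ^ 2 * φ w) i
  simp only [map_mul, map_pow]
  rw [← mul_mul_sq_mul_of_mem_closure hM _ hφw]
  simpa only [mul_assoc] using hpow.symm

/-- The syntactic monoid of the language `{x, y}* t y {x, y}*`, a monoid satisfying the identities
that define `β`. Here `x` and `y` stand for the nonempty words over `{x, y}` with that first letter,
`t` for the words of `{x, y}* t`, `ty` for those of the language, and `zero` for the words that are
not factors of any word of the language. -/
inductive AfterMonoid : Type
  | zero | one | x | y | t | ty
  deriving DecidableEq

namespace AfterMonoid

instance : Fintype AfterMonoid where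
  elems := {zero, one, x, y, t, ty}
  complete f := by cases f <;> decide

/-- Concatenation of words, on their classes. -/
protected def mul : AfterMonoid → AfterMonoid → AfterMonoid
  | one, g => g
  | f, one => f
  | x, x | x, y => x
  | y, x | y, y => y
  | x, t | y, t => t
  | x, ty | y, ty | t, y | ty, x | ty, y => ty
  | _, _ => zero

instance : Monoid AfterMonoid where
  mul := AfterMonoid.mul
  one := one
  mul_assoc := by
    change ∀ f g h, AfterMonoid.mul (AfterMonoid.mul f g) h = .mul f (.mul g h)
    decide
  one_mul := by
    change ∀ f, AfterMonoid.mul one f = f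
    decide
  mul_one := by
    change ∀ f, AfterMonoid.mul f one = f
    decide

theorem mem_ofIdentities_betaIdentities :
    (MonoidVariety.ofIdentities.{0} betaIdentities).Mem AfterMonoid := by
  simp only [mem_ofIdentities_betaIdentities_iff, pow_two]
  decide

end AfterMonoid

theorem mul_mul_mul_notMem_betaClass {a b t : ℕ} (hab : a ≠ b) (hat : a ≠ t) (hbt : b ≠ t)
    (p q : Word) : p * letter t * letter a * q ∉
      betaClass (letter a * letter t * letter b ^ 2 * letter a) := by
  intro h
  let φ : Word →* AfterMonoid :=
    FreeMonoid.lift fun c => if c = a then .x else if c = b then .y else .t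
  have ha : φ (letter a) = .x := by simp [φ]
  have hb : φ (letter b) = .y := by simp [φ, hab.symm]
  have ht : φ (letter t) = .t := by simp [φ, hat.symm, hbt.symm]
  have hφ := h AfterMonoid AfterMonoid.mem_ofIdentities_betaIdentities φ
  simp only [map_mul, ha, hb, ht, pow_two] at hφ
  generalize φ p = f, φ q = g at hφ
  revert f g
  decide

end Beta

namespace MonoidVariety
variable {V : MonoidVariety.{u}}

section Satisfies
variable {p q : Word}

theorem Satisfies.symm (h : V.Satisfies p q) : V.Satisfies q p :=
  fun M _ hM φ => (h M hM φ).symm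

theorem Satisfies.map (h : V.Satisfies p q) (φ : Word →* Word) : V.Satisfies (φ p) (φ q) :=
  fun M _ hM ψ => h M hM (ψ.comp φ)

theorem Satisfies.mul_mul (h : V.Satisfies p q) (A B : Word) :
    V.Satisfies (A * p * B) (A * q * B) :=
  fun M _ hM φ => by simp only [map_mul, h M hM φ]

/-- `V` satisfies the identity `p₁ z p₂ ≈ q₁ z q₂`, where `z` is a letter occurring in none of the
four words; the value of `z` is the element `m` below. -/
def SatisfiesAround (V : MonoidVariety.{u}) (p₁ p₂ q₁ q₂ : Word) : Prop :=
  ∀ (M : Type u) [Monoid M], V.Mem M → ∀ (φ : Word →* M) (m : M),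
    φ p₁ * m * φ p₂ = φ q₁ * m * φ q₂

variable {p₁ p₂ q₁ q₂ : Word}

theorem SatisfiesAround.map (h : V.SatisfiesAround p₁ p₂ q₁ q₂) (φ : Word →* Word) :
    V.SatisfiesAround (φ p₁) (φ p₂) (φ q₁) (φ q₂) :=
  fun M _ hM ψ m => h M hM (ψ.comp φ) m

theorem SatisfiesAround.satisfies (h : V.SatisfiesAround p₁ p₂ q₁ q₂) (w : Word) :
    V.Satisfies (p₁ * w * p₂) (q₁ * w * q₂) :=
  fun M _ hM φ => by simpa only [map_mul] using h M hM φ (φ w)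

theorem Satisfies.around_one_right (h : V.Satisfies p q) : V.SatisfiesAround p 1 q 1 :=
  fun M _ hM φ m => by rw [h M hM φ]

theorem Satisfies.around_one_left (h : V.Satisfies p q) : V.SatisfiesAround 1 p 1 q :=
  fun M _ hM φ m => by rw [h M hM φ]

theorem Satisfies.around_of_notMem {z : ℕ}
    (h : V.Satisfies (p₁ * letter z * p₂) (q₁ * letter z * q₂))
    (hp₁ : z ∉ p₁) (hp₂ : z ∉ p₂) (hq₁ : z ∉ q₁) (hq₂ : z ∉ q₂) :
    V.SatisfiesAround p₁ p₂ q₁ q₂ := by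
  intro M _ hM φ m
  let ψ : Word →* M := FreeMonoid.lift (Function.update (fun c => φ (letter c)) z m)
  have hψ {w : Word} (hw : z ∉ w) : ψ w = φ w :=
    map_eq_map_of_forall_mem fun c hc => by simp [ψ, ne_of_mem_of_not_mem hc hw]
  have hz : ψ (letter z) = m := by simp [ψ]
  simpa only [map_mul, hψ, hp₁, hp₂, hq₁, hq₂, hz, not_false_eq_true] using h M hM ψ

end Satisfies
end MonoidVariety

section SquareSubst
variable {a b t x y : ℕ} {w : Word}

/-- The substitution `x ↦ a`, `y ↦ b²`, all other letters `↦ 1`. It turns words in which the order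
of `x` and `y` is restricted into words of `a⁺bb⁺ta⁺` and `[atb²a]_β`. -/
def squareSubst (a b x y : ℕ) : Word →* Word :=
  FreeMonoid.lift fun c => if c = x then letter a else if c = y then letter b ^ 2 else 1

theorem squareSubst_left : squareSubst a b x y (letter x) = letter a := by
  simp [squareSubst]

theorem squareSubst_right (hxy : x ≠ y) : squareSubst a b x y (letter y) = letter b ^ 2 := by
  simp [squareSubst, hxy.symm]

theorem squareSubst_eq_pow_left (hy : y ∉ w) :
    squareSubst a b x y w = letter a ^ w.toList.count x := by
  rw [map_eq_pow_count (x := x) fun c hc hcx => ?_, squareSubst_left]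
  simp [squareSubst, hcx, ne_of_mem_of_not_mem hc hy]

theorem squareSubst_eq_pow_right (hxy : x ≠ y) (hx : x ∉ w) :
    squareSubst a b x y w = (letter b ^ 2) ^ w.toList.count y := by
  rw [map_eq_pow_count (x := y) fun c hc hcy => ?_, squareSubst_right hxy]
  simp [squareSubst, hcy, ne_of_mem_of_not_mem hc hx]

theorem squareSubst_mem_closure :
    squareSubst a b x y w ∈ Submonoid.closure {letter a, letter b} := by
  induction w using FreeMonoid.recOn with
  | one => simp
  | of_mul c w ih =>
    rw [map_mul]
    refine mul_mem ?_ ih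
    simp only [squareSubst, FreeMonoid.lift_eval_of]
    split_ifs
    · exact Submonoid.subset_closure (by simp)
    · exact pow_mem (Submonoid.subset_closure (by simp)) 2
    · exact one_mem _

theorem notMem_squareSubst (hat : a ≠ t) (hbt : b ≠ t) : t ∉ squareSubst a b x y w := by
  rw [mem_freeMonoidHom_apply_iff]
  rintro ⟨c, -, hc⟩
  simp only [squareSubst, FreeMonoid.lift_eval_of] at hc
  split_ifs at hc
  · exact hat (FreeMonoid.mem_of.1 hc).symm
  · exact hbt (FreeMonoid.mem_of.1 (mem_of_mem_freeMonoid_pow hc)).symm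
  · exact FreeMonoid.notMem_one hc

end SquareSubst

section APlusBBPlusTAPlus
variable {a b t : ℕ} {w : Word}

theorem count_eq_one_of_mem_aPlusBBPlusTAPlus (hat : a ≠ t) (hbt : b ≠ t)
    (hw : w ∈ aPlusBBPlusTAPlus (letter a) (letter b) (letter t)) : w.toList.count t = 1 := by
  obtain ⟨i, j, k, -, -, -, rfl⟩ := hw
  simp [FreeMonoid.toList_mul, count_toList_pow, hat, hbt]

theorem gapFree_of_mem_aPlusBBPlusTAPlus (hab : a ≠ b) (hat : a ≠ t)
    (hw : w ∈ aPlusBBPlusTAPlus (letter a) (letter b) (letter t)) : GapFree a b t w := by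
  obtain ⟨i, j, k, -, -, -, rfl⟩ := hw
  have hb : b ∉ letter a ^ i := fun h =>
    hab.symm (FreeMonoid.mem_of.1 (mem_of_mem_freeMonoid_pow h))
  have ha : a ∉ letter b ^ (j + 1) * letter t := by
    rw [FreeMonoid.mem_mul]
    rintro (h | h)
    · exact hab (FreeMonoid.mem_of.1 (mem_of_mem_freeMonoid_pow h))
    · exact hat (FreeMonoid.mem_of.1 h)
  have hw : letter a ^ i * letter b * letter b ^ j * letter t * letter a ^ k =
      letter a ^ i * (letter b ^ (j + 1) * letter t) * letter a ^ k := by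
    simp only [pow_succ', mul_assoc]
  rw [hw, GapFree, beforeEach_mul, beforeEach_mul]
  exact ⟨⟨fun s r hs hbs => (hb (by simp [hs, hbs])).elim, beforeEach_of_notMem ha⟩,
    fun s r _ _ => by simp⟩

end APlusBBPlusTAPlus

namespace MonoidVariety
variable {V : MonoidVariety.{u}}

/-- The part of the equational theory of `V` on which the argument rests: identities preserve the
content and the letters that occur once, and, in an identity `p₁ z p₂ ≈ q₁ z q₂` with a marker `z`,
the orders "`x` only before `y`" to the left of `z` (if `y` does not occur to its right) and
"`x` only after `y`" to the right of `z` (if `y` does not occur to its left). -/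
structure OrderPreserving (V : MonoidVariety.{u}) : Prop where
  count_eq {p q : Word} {c : ℕ} : V.Satisfies p q → p.toList.count c ≤ 1 →
    q.toList.count c = p.toList.count c
  beforeEach_notMem_of_around {p₁ p₂ q₁ q₂ : Word} {x y : ℕ} : V.SatisfiesAround p₁ p₂ q₁ q₂ →
    x ≠ y → y ∉ p₂ → BeforeEach x (y ∉ ·) p₁ → BeforeEach x (y ∉ ·) q₁
  beforeEach_mem_of_around {p₁ p₂ q₁ q₂ : Word} {x y : ℕ} : V.SatisfiesAround p₁ p₂ q₁ q₂ →
    x ≠ y → y ∉ p₁ → y ∈ p₂ → BeforeEach x (y ∈ ·) p₂ → BeforeEach x (y ∈ ·) q₂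

section Stable
variable {a b t x y c : ℕ} {p q p₁ p₂ q₁ q₂ : Word}

theorem count_eq_of_stable (hat : a ≠ t) (hbt : b ≠ t)
    (h₁ : V.Stable (aPlusBBPlusTAPlus (letter a) (letter b) (letter t)))
    (h : V.Satisfies p q) (hc : p.toList.count c ≤ 1) :
    q.toList.count c = p.toList.count c := by
  let σ : Word →* Word := FreeMonoid.lift fun d => if d = c then letter t else 1
  have hσ (w : Word) : σ w = letter t ^ w.toList.count c := by
    rw [map_eq_pow_count (x := c) fun d _ hd => by simp [σ, hd]]
    simp [σ]
  let A := letter a * letter b * letter b * letter t ^ (1 - p.toList.count c)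
  have hp : A * σ p * letter a ∈ aPlusBBPlusTAPlus (letter a) (letter b) (letter t) := by
    refine ⟨1, 1, 1, le_rfl, le_rfl, le_rfl, ?_⟩
    simp only [A, hσ, pow_one]
    rw [mul_assoc _ (letter t ^ _) (letter t ^ _), ← pow_add, Nat.sub_add_cancel hc, pow_one]
  have hq := count_eq_one_of_mem_aPlusBBPlusTAPlus hat hbt
    (h₁ _ hp _ ((h.map σ).mul_mul A (letter a)))
  have : 1 - p.toList.count c + q.toList.count c = 1 := by
    simpa [hσ, A, FreeMonoid.toList_mul, count_toList_pow, hat, hbt] using hq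
  omega

theorem beforeEach_notMem_of_stable (hab : a ≠ b) (hat : a ≠ t) (hbt : b ≠ t)
    (h₁ : V.Stable (aPlusBBPlusTAPlus (letter a) (letter b) (letter t)))
    (h : V.SatisfiesAround p₁ p₂ q₁ q₂) (hxy : x ≠ y) (hy₁ : y ∈ p₁) (hy₂ : y ∉ p₂)
    (hp : BeforeEach x (y ∉ ·) p₁) : BeforeEach x (y ∉ ·) q₁ := by
  obtain ⟨s, r, rfl, hs, hr⟩ := exists_split_of_beforeEach_notMem hy₁ hp
  let σ := squareSubst a b x y
  have hmem : letter a * σ (s * letter y * r) * letter t * σ p₂ * letter a ∈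
      aPlusBBPlusTAPlus (letter a) (letter b) (letter t) := by
    refine ⟨s.toList.count x + 1, 2 * r.toList.count y + 1, p₂.toList.count x + 1,
      by simp, by simp, by simp, ?_⟩
    simp only [σ, map_mul, squareSubst_eq_pow_left hs, squareSubst_right hxy,
      squareSubst_eq_pow_right hxy hr, squareSubst_eq_pow_left hy₂, ← pow_mul]
    simp only [pow_succ' _ (s.toList.count x), pow_succ _ (p₂.toList.count x),
      pow_succ' _ (2 * r.toList.count y), pow_two, mul_assoc]
  have hsat : V.Satisfies (letter a * σ (s * letter y * r) * letter t * σ p₂ * letter a)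
      (letter a * σ q₁ * letter t * σ q₂ * letter a) := by
    simpa only [mul_assoc] using ((h.map σ).satisfies (letter t)).mul_mul (letter a) (letter a)
  have hgap := gapFree_of_mem_aPlusBBPlusTAPlus hab hat (h₁ _ hmem _ hsat)
  rintro s' r' rfl hy
  have hb : b ∈ letter a * σ s' := FreeMonoid.mem_mul.2 <| .inr <|
    (mem_freeMonoidHom_apply_iff σ s' b).2 ⟨y, hy, by simp [σ, squareSubst_right hxy, pow_two]⟩
  have ht : t ∉ letter a * σ s' := by
    simp [hat.symm, σ, notMem_squareSubst hat hbt]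
  refine ht (hgap _ (σ r' * letter t * σ q₂ * letter a) ?_ hb)
  simp only [map_mul, mul_assoc, σ, squareSubst_left]

theorem beforeEach_mem_of_stable (hab : a ≠ b) (hat : a ≠ t) (hbt : b ≠ t)
    (h₂ : V.Stable (betaClass (letter a * letter t * letter b ^ 2 * letter a)))
    (h : V.SatisfiesAround p₁ p₂ q₁ q₂) (hxy : x ≠ y) (hy₁ : y ∉ p₁) (hy₂ : y ∈ p₂)
    (hp : BeforeEach x (y ∈ ·) p₂) : BeforeEach x (y ∈ ·) q₂ := by
  obtain ⟨s, r, rfl, hys, hxs⟩ := exists_split_of_beforeEach_mem hy₂ hp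
  let σ := squareSubst a b x y
  have hmem : letter a * σ p₁ * letter t * σ (s * letter y * r) * letter a ∈
      betaClass (letter a * letter t * letter b ^ 2 * letter a) := by
    have hs : σ s = 1 := by
      have hs₀ : s.toList.count x = 0 := List.count_eq_zero.2 hxs
      rw [squareSubst_eq_pow_left hys, hs₀, pow_zero]
    rw [map_mul, map_mul, hs, one_mul]
    simp only [σ, squareSubst_eq_pow_left hy₁, squareSubst_right hxy]
    simpa only [pow_succ', mul_assoc] using
      pow_mul_mul_sq_mul_mul_mem_betaClass a b t (p₁.toList.count x)
        (squareSubst_mem_closure (x := x) (y := y) (w := r))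
  have hsat : V.Satisfies (letter a * σ p₁ * letter t * σ (s * letter y * r) * letter a)
      (letter a * σ q₁ * letter t * σ q₂ * letter a) := by
    simpa only [mul_assoc] using ((h.map σ).satisfies (letter t)).mul_mul (letter a) (letter a)
  rintro s' r' rfl
  by_contra hy
  refine mul_mul_mul_notMem_betaClass hab hat hbt (letter a * σ q₁)
    (letter a ^ s'.toList.count x * σ r' * letter a) ?_
  convert h₂ _ hmem _ hsat using 1
  simp only [map_mul, σ, squareSubst_left, squareSubst_eq_pow_left hy, mul_assoc]
  rw [← mul_assoc (letter a) (letter a ^ _), ← pow_succ', pow_succ, mul_assoc]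

theorem orderPreserving_of_stable (hab : a ≠ b) (hat : a ≠ t) (hbt : b ≠ t)
    (h₁ : V.Stable (aPlusBBPlusTAPlus (letter a) (letter b) (letter t)))
    (h₂ : V.Stable (betaClass (letter a * letter t * letter b ^ 2 * letter a))) :
    V.OrderPreserving where
  count_eq := count_eq_of_stable hat hbt h₁
  beforeEach_notMem_of_around {p₁ p₂ q₁ q₂ x y} h hxy hy₂ hp := by
    by_cases hy₁ : y ∈ p₁
    · exact beforeEach_notMem_of_stable hab hat hbt h₁ h hxy hy₁ hy₂ hp
    have hp0 : (p₁ * 1 * p₂).toList.count y = 0 := List.count_eq_zero.2 (by simpa using ⟨hy₁, hy₂⟩)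
    have hq0 := count_eq_of_stable hat hbt h₁ (h.satisfies 1) (hp0.le.trans zero_le_one)
    have hq : y ∉ q₁ * 1 * q₂ := List.count_eq_zero.1 (hq0.trans hp0)
    exact beforeEach_notMem_of_notMem fun hy => hq (by simp [hy])
  beforeEach_mem_of_around := beforeEach_mem_of_stable hab hat hbt h₂

end Stable

namespace OrderPreserving
variable {p q p₁ p₂ q₁ q₂ u v : Word} {x y z : ℕ}

theorem mem_iff (hV : V.OrderPreserving) (h : V.Satisfies p q) : x ∈ p ↔ x ∈ q := by
  have key {p q : Word} (h : V.Satisfies p q) (hx : x ∉ p) : x ∉ q := by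
    have hp : p.toList.count x = 0 := List.count_eq_zero.2 hx
    exact List.count_eq_zero.1 ((hV.count_eq h (hp.le.trans zero_le_one)).trans hp)
  exact not_iff_not.1 ⟨key h, key h.symm⟩

theorem beforeEach_notMem (hV : V.OrderPreserving) (h : V.Satisfies p q) (hxy : x ≠ y)
    (hp : BeforeEach x (y ∉ ·) p) : BeforeEach x (y ∉ ·) q :=
  hV.beforeEach_notMem_of_around h.around_one_right hxy FreeMonoid.notMem_one hp

theorem beforeEach_mem (hV : V.OrderPreserving) (h : V.Satisfies p q) (hxy : x ≠ y)
    (hp : BeforeEach x (y ∈ ·) p) : BeforeEach x (y ∈ ·) q := by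
  by_cases hy : y ∈ p
  · exact hV.beforeEach_mem_of_around h.around_one_left hxy FreeMonoid.notMem_one hy hp
  refine beforeEach_of_notMem fun hx => hy ?_
  obtain ⟨s, r, rfl, -⟩ := exists_split_of_mem ((hV.mem_iff h).2 hx)
  simp [hp s r rfl]

theorem exists_satisfiesAround (hV : V.OrderPreserving) (h : V.Satisfies u v)
    (hz : u.toList.count z = 1) : ∃ u₁ u₂ v₁ v₂, u = u₁ * letter z * u₂ ∧
      v = v₁ * letter z * v₂ ∧ V.SatisfiesAround u₁ u₂ v₁ v₂ := by
  obtain ⟨u₁, u₂, hu, hu₁, hu₂⟩ := exists_split_of_count_eq_one hz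
  obtain ⟨v₁, v₂, hv, hv₁, hv₂⟩ :=
    exists_split_of_count_eq_one ((hV.count_eq h hz.le).trans hz)
  subst hu hv
  exact ⟨u₁, u₂, v₁, v₂, rfl, rfl, h.around_of_notMem hu₁ hu₂ hv₁ hv₂⟩

theorem gapFree_mul_mul (hV : V.OrderPreserving) (h : V.SatisfiesAround p₁ p₂ q₁ q₂) {m : Word}
    (hxy : x ≠ y) (hxz : x ≠ z) (hy₁ : y ∈ p₁ * m) (hy₂ : y ∉ p₂) (hz₁ : z ∉ p₁)
    (hz₂ : z ∈ m * p₂) (hp : GapFree x y z (p₁ * m * p₂)) : GapFree x y z (q₁ * m * q₂) := by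
  simp only [GapFree, beforeEach_mul] at hp ⊢
  obtain ⟨⟨hp₁, hm⟩, hp₂⟩ := hp
  have hyq (hy : y ∈ q₁) : y ∈ p₁ := by
    simpa [hy₂] using (hV.mem_iff (h.satisfies 1)).2 (by simp [hy] : y ∈ q₁ * 1 * q₂)
  refine ⟨⟨?_, ?_⟩, ?_⟩
  · exact (hV.beforeEach_notMem_of_around h hxy hy₂ (GapFree.beforeEach_notMem hp₁ hz₁)).gapFree
  · refine hm.mono fun s _ _ hsz hy => ?_
    have hy' : y ∈ p₁ * s := FreeMonoid.mem_mul.2 ((FreeMonoid.mem_mul.1 hy).imp_left hyq)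
    exact FreeMonoid.mem_mul.2 (.inr ((FreeMonoid.mem_mul.1 (hsz hy')).resolve_left hz₁))
  · by_cases hzm : z ∈ m
    · exact fun s r _ _ => by simp [hzm]
    have hp₂' : BeforeEach x (z ∈ ·) p₂ := hp₂.mono fun s _ _ hsz => by
      have := hsz (FreeMonoid.mem_mul.2 (.inl hy₁))
      simpa [hz₁, hzm] using this
    exact (hV.beforeEach_mem_of_around h hxz hz₁
      ((FreeMonoid.mem_mul.1 hz₂).resolve_left hzm) hp₂').mono fun s r _ hs _ => by simp [hs]

end OrderPreserving

end MonoidVariety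

/-- All letters `1, …, n` occur in `w`, and each occurrence of `i` precedes each occurrence of `j`
for `i < j` among them. -/
def BlockOrdered (n : ℕ) (w : Word) : Prop :=
  (∀ i ∈ Finset.Icc 1 n, i ∈ w) ∧
    ∀ i j, 1 ≤ i → i < j → j ≤ n → BeforeEach i (j ∉ ·) w

section BlockOrdered
variable {n : ℕ} {A B w : Word}

theorem BlockOrdered.forall_mem_of_mem (h : BlockOrdered n (A * w * B)) (h₁ : 1 ∈ w) (hn : n ∈ w) :
    ∀ i ∈ Finset.Icc 1 n, i ∈ w := by
  intro i hi
  obtain ⟨h1i, hin⟩ := Finset.mem_Icc.1 hi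
  obtain rfl | h1i := h1i.eq_or_lt
  · exact h₁
  obtain rfl | hin := hin.eq_or_lt
  · exact hn
  have hA : i ∉ A := (mul_assoc A w B ▸ h.2 1 i le_rfl h1i hin.le).notMem_left (by simp [h₁])
  have hB : i ∉ B := fun hB => (h.2 i n h1i.le hin le_rfl).notMem_left hB (by simp [hn])
  simpa [hA, hB] using h.1 i hi

/-- The inner part `y₁² y₂² ⋯ yₙ²` of `wordU n`. -/
def squares (n : ℕ) : Word := ((List.range n).map fun i => letter (i + 1) ^ 2).prod

theorem squares_succ : squares (n + 1) = squares n * letter (n + 1) ^ 2 := by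
  simp [squares, List.range_succ]

theorem mem_squares {c : ℕ} : c ∈ squares n ↔ 1 ≤ c ∧ c ≤ n := by
  induction n with
  | zero => exact iff_of_false FreeMonoid.notMem_one (by omega)
  | succ n ih =>
    rw [squares_succ, FreeMonoid.mem_mul, ih, pow_two, FreeMonoid.mem_mul, or_self,
      FreeMonoid.mem_of]
    omega

theorem beforeEach_notMem_squares {i j : ℕ} (hij : i < j) : BeforeEach i (j ∉ ·) (squares n) := by
  induction n with
  | zero => exact beforeEach_of_notMem FreeMonoid.notMem_one
  | succ n ih =>
    by_cases hj : j ≤ n + 1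
    · rw [squares_succ, beforeEach_mul]
      exact ⟨ih, beforeEach_of_notMem (by simp [pow_two, (hij.trans_le hj).ne])⟩
    · exact beforeEach_notMem_of_notMem fun h => hj (mem_squares.1 h).2

theorem wordU_eq : wordU n = letter 0 * squares n * letter 0 := rfl

theorem blockOrdered_wordU : BlockOrdered n (wordU n) := by
  rw [wordU_eq]
  refine ⟨fun i hi => ?_, fun i j hi hij _ => ?_⟩
  · simp [mem_squares.2 (Finset.mem_Icc.1 hi)]
  have hi0 : i ∉ letter 0 := fun h => by
    have := FreeMonoid.mem_of.1 h
    omega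
  have hj0 : j ∉ letter 0 := fun h => by
    have := FreeMonoid.mem_of.1 h
    omega
  rw [beforeEach_mul, beforeEach_mul]
  refine ⟨⟨beforeEach_of_notMem hi0, ?_⟩, beforeEach_of_notMem hi0⟩
  exact (beforeEach_notMem_squares hij).mono fun s _ _ hs => by
    rw [FreeMonoid.mem_mul]
    exact not_or.2 ⟨hj0, hs⟩

theorem gapFree_wordU (hn : 1 ≤ n) : GapFree 0 1 n (wordU n) := by
  have h0 : 0 ∉ squares n := fun h => by simpa using (mem_squares.1 h).1
  rw [wordU_eq, GapFree, beforeEach_mul, beforeEach_mul]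
  refine ⟨⟨fun s r hs h₁ => ?_, beforeEach_of_notMem h0⟩, fun s _ _ _ => ?_⟩
  · exact (one_ne_zero (FreeMonoid.mem_of.1 (hs ▸ by simp [h₁] : 1 ∈ letter 0))).elim
  · simp [mem_squares.2 ⟨hn, le_rfl⟩]

theorem not_gapFree_wordV (hn : 2 ≤ n) : ¬ GapFree 0 1 n (wordV n) := by
  obtain ⟨k, rfl⟩ := Nat.exists_eq_add_of_le' hn
  intro h
  have := h (letter 0 * letter 1 ^ 2)
    ((List.range (k + 1)).map fun i => letter (i + 2) ^ 2 * letter 0).prod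
    (by simp [wordV, List.range_succ_eq_map, Function.comp_def, mul_assoc])
  simp [pow_two] at this

end BlockOrdered

namespace MonoidVariety.OrderPreserving
variable {V : MonoidVariety.{u}} {u v p q A B : Word} {n : ℕ}

theorem blockOrdered (hV : V.OrderPreserving) (h : V.Satisfies p q) (hp : BlockOrdered n p) :
    BlockOrdered n q :=
  ⟨fun i hi => (hV.mem_iff h).1 (hp.1 i hi),
    fun i j hi hij hj => hV.beforeEach_notMem h hij.ne (hp.2 i j hi hij hj)⟩

theorem gapFree_map_of_mem (hV : V.OrderPreserving) (h : V.Satisfies u v)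
    (hcard : u.symbols.card < n) {φ : Word →* Word} (hb : BlockOrdered n (A * φ u * B))
    (h₁ : 1 ∈ φ u) (hn : n ∈ φ u) (hp : GapFree 0 1 n (φ u)) : GapFree 0 1 n (φ v) := by
  obtain ⟨c, hc, k, hk, l, hl, hkl, hkc, hlc⟩ :=
    exists_ne_mem_map_of_card_symbols_lt (hb.forall_mem_of_mem h₁ hn) (by simpa using hcard)
  wlog hlt : k < l generalizing k l
  · exact this l hl k hk hkl.symm hlc hkc (hkl.lt_of_le' (not_lt.1 hlt))
  have h1k := (Finset.mem_Icc.1 hk).1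
  have hln := (Finset.mem_Icc.1 hl).2
  have hφ (i j : ℕ) (hi : 1 ≤ i) (hij : i < j) (hj : j ≤ n) : BeforeEach i (j ∉ ·) (φ u) :=
    (hb.2 i j hi hij hj).notMem_middle
  obtain ⟨u₁, u₂, v₁, v₂, rfl, rfl, huv⟩ := hV.exists_satisfiesAround h
    (count_eq_one_of_beforeEach_notMem_map (hφ k l h1k hlt hln) hc hkc hlc)
  simp only [map_mul] at hφ h₁ hn hp ⊢
  have h₁u₂ : 1 ∉ φ u₂ := fun h1 =>
    (hφ 1 l le_rfl (h1k.trans_lt hlt) hln).notMem_left h1 (by simp [hlc])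
  have hnu₁ : n ∉ φ u₁ := by
    have := hφ k n h1k (hlt.trans_le hln) le_rfl
    rw [mul_assoc] at this
    exact this.notMem_left (by simp [hkc])
  refine hV.gapFree_mul_mul (huv.map φ) zero_ne_one (by omega)
    ((FreeMonoid.mem_mul.1 h₁).resolve_right h₁u₂) h₁u₂ hnu₁ ?_ hp
  rw [mul_assoc] at hn
  exact (FreeMonoid.mem_mul.1 hn).resolve_left hnu₁

theorem gapFree_mul_map_mul (hV : V.OrderPreserving) (h : V.Satisfies u v)
    (hcard : u.symbols.card < n) {φ : Word →* Word} (hb : BlockOrdered n (A * φ u * B))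
    (hp : GapFree 0 1 n (A * φ u * B)) : GapFree 0 1 n (A * φ v * B) := by
  have hn0 : 0 ≠ n := by omega
  have hcontent (c : ℕ) : c ∈ φ u ↔ c ∈ φ v := hV.mem_iff (h.map φ)
  simp only [GapFree, beforeEach_mul, FreeMonoid.mem_mul, ← hcontent] at hp ⊢
  obtain ⟨⟨hA, hu⟩, hB⟩ := hp
  refine ⟨⟨hA, ?_⟩, hB⟩
  by_cases hnA : n ∈ A
  · exact fun _ _ _ _ => .inl hnA
  by_cases h1A : 1 ∈ A
  · simp only [h1A, hnA, true_or, false_or, true_imp_iff] at hu ⊢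
    exact hV.beforeEach_mem (h.map φ) hn0 hu
  simp only [h1A, hnA, false_or] at hu ⊢
  by_cases h1u : 1 ∈ φ u
  · by_cases hnu : n ∈ φ u
    · exact hV.gapFree_map_of_mem h hcard hb h1u hnu hu
    exact (hV.beforeEach_notMem (h.map φ) zero_ne_one (GapFree.beforeEach_notMem hu hnu)).gapFree
  · exact (beforeEach_notMem_of_notMem ((hcontent 1).not.1 h1u)).gapFree

theorem not_finitelyBased (hV : V.OrderPreserving)
    (hUV : ∀ n : ℕ, 1 ≤ n → V.Satisfies (wordU n) (wordV n)) : ¬ V.FinitelyBased := by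
  rintro ⟨S, hS, hVS⟩
  obtain ⟨N, hN⟩ := (hS.image fun e => max e.1.symbols.card e.2.symbols.card).bddAbove
  have hlt : ∀ e ∈ S, max e.1.symbols.card e.2.symbols.card < N + 2 := fun e he =>
    (hN (Set.mem_image_of_mem _ he)).trans_lt (by omega)
  have hVe : ∀ e ∈ S, V.Satisfies e.1 e.2 := fun e he => (hVS _ _).2 fun M _ hM => hM e he
  let L : Set Word := {w | BlockOrdered (N + 2) w ∧ GapFree 0 1 (N + 2) w}
  have closed {u v : Word} (h : V.Satisfies u v) (hu : u.symbols.card < N + 2) (φ : Word →* Word)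
      (A B : Word) (hL : A * φ u * B ∈ L) : A * φ v * B ∈ L :=
    ⟨hV.blockOrdered ((h.map φ).mul_mul A B) hL.1, hV.gapFree_mul_map_mul h hu hL.1 hL.2⟩
  have hL : ∀ e ∈ S, ∀ (φ : Word →* Word) (A B : Word), A * φ e.1 * B ∈ L ↔ A * φ e.2 * B ∈ L :=
    fun e he φ A B => ⟨closed (hVe e he) (max_lt_iff.1 (hlt e he)).1 φ A B,
      closed (hVe e he).symm (max_lt_iff.1 (hlt e he)).2 φ A B⟩
  have hU : wordU (N + 2) ∈ L := ⟨blockOrdered_wordU, gapFree_wordU (by omega)⟩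
  have hS' := (hVS _ _).1 (hUV (N + 2) (by omega))
  exact not_gapFree_wordV (by omega) ((mem_iff_mem_of_ofIdentities_satisfies hL hS').1 hU).2

end MonoidVariety.OrderPreserving

theorem mainTheorem2 (V : MonoidVariety.{u})
    (hV : ∀ n : ℕ, 1 ≤ n → V.Satisfies (wordU n) (wordV n))
    (a b t : ℕ) (hab : a ≠ b) (hat : a ≠ t) (hbt : b ≠ t)
    (h₁ : V.Stable (aPlusBBPlusTAPlus (letter a) (letter b) (letter t)))
    (h₂ : V.Stable (betaClass (letter a * letter t * letter b ^ 2 * letter a))) :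
    ¬ V.FinitelyBased :=
  (MonoidVariety.orderPreserving_of_stable hab hat hbt h₁ h₂).not_finitelyBased hV
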